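/- Fix finite sets $\Theta$ (agent types), $\mathcal A$ (actions) and $\Omega$ (outcomes) with $m=|\Omega|$, a distribution $\lambda$ on $\Theta$, outcome distributions $F_{\theta,a}$ on $\Omega$, costs $c_{\theta,a}\in[0,1]$ and rewards $r\in[0,1]^\Omega$. For a contract $p\in\mathbb R_{\ge 0}^\Omega$ put $u^{\mathsf A}(p,a,\theta)=F_{\theta,a}\cdot p-c_{\theta,a}$ and $u^{\mathsf P}(p,a,\theta)=F_{\theta,a}\cdot(r-p)$. For $\delta\in(0,1)$ let $A^{\theta,\delta}(p)$ be the set of actions $a$ with $u^{\mathsf A}(p,a,\theta)>\max_{a'}u^{\mathsf A}(p,a',\theta)-\delta$, and let $a^{\theta,\delta}(p)\in\arg\min_{a\in A^{\theta,\delta}(p)}u^{\mathsf P}(p,a,\theta)$ (ties broken arbitrarily). Let $U_\delta(p)=\sum_\theta\lambda_\theta\,u^{\mathsf P}(p,a^{\theta,\delta}(p),\theta)$, $\mathcal C=[0,1]^\Omega$ and $\mathrm{OPT}(\mathcal C,\delta)=\max_{p\in\mathcal C}U_\delta(p)$. In each round $t=1,\dots,T$ a type $\theta^t\sim\lambda$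 is drawn independently of the past, the principal, who does not see $\theta^t$, posts a contract $p^t\in\mathcal C$ chosen from what was observed before, the agent plays $a^t=a^{\theta^t,\delta}(p^t)$, which the principal does not see, an outcome $\omega^t\sim F_{\theta^t,a^t}$ is drawn, and the principal observes it and receives the utility $r_{\omega^t}-p^t_{\omega^t}\in[-1,1]$. The pseudo-regret is $$R_T(\mathcal C,\delta)=T\,\mathrm{OPT}(\mathcal C,\delta)-\mathbb E\Big[\sum_{t=1}^T U_\delta(p^t)\Big].$$ The algorithm sets $\epsilon=T^{-1/(m+1)}$ and runs UCB1 with the grid $\mathcal B_\epsilon=\{p\in[0,1]^\Omega: p_\omega\in\{0,\epsilon,2\epsilon,\dots,1\}\ \forall\omega\}$ as set of arms (each coordinate is a multiple of $\epsilon$ in $[0,1]$, or $1$), on the rewards $x^t=(1+r_{\omega^t}-p^t_{\omega^t})/2\in[0,1]$: as long as some arm has not been played, it plays such an arm; afterwards it plays an arm $p$ that maximizes $\bar x_p+\sqrt{2\ln n/n_p}$, where $\bar x_p$ is the average reward obtained from $p$, $n_p$ the number of plays of $p$ and $n$ the total number of plays so far (the initial order and the ties are arbitrary). **Theorem.** The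 maximum that defines $\mathrm{OPT}(\mathcal C,\delta)$ is attained, and $$R_T(\mathcal C,\delta)\le\widetilde{\mathcal O}\big(T^{1-\frac1{2(m+1)}}\big),$$ that is: there are absolute constants $C>0$ and $k\in\mathbb N$ such that for every instance as above, every $\delta\in(0,1)$ and every $T\ge1$ the algorithm satisfies $R_T(\mathcal C,\delta)\le C\,(1+\ln T)^k\,T^{1-\frac1{2(m+1)}}$. -/

import Mathlib

/-! ### Hidden-action principal-agent problems with agent types -/

/-- A hidden-action principal-agent problem with finite sets `Θ` of agent types, `A` of actions and
`O` of outcomes. Contracts are vectors `p : O → ℝ`. -/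
structure PrincipalAgent (Θ A O : Type*) where
  /-- distribution of the agent's type -/
  typeLaw : PMF Θ
  /-- outcome distribution of each action, for each type -/
  F : Θ → A → PMF O
  /-- cost of each action, for each type -/
  c : Θ → A → ℝ
  /-- the principal's reward for each outcome -/
  r : O → ℝ
  c_mem : ∀ θ a, c θ a ∈ Set.Icc (0 : ℝ) 1
  r_mem : ∀ ω, r ω ∈ Set.Icc (0 : ℝ) 1

namespace PrincipalAgent

variable {Θ A O : Type*} [Fintype Θ] [Fintype O]

/-- Expected utility of an agent of type `θ` for playing `a` under `p`: `F_{θ,a} ⬝ p - c_{θ,a}`. -/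
noncomputable def agentUtility (P : PrincipalAgent Θ A O) (θ : Θ) (p : O → ℝ) (a : A) : ℝ :=
  ∑ ω, (P.F θ a ω).toReal * p ω - P.c θ a

/-- Expected utility of the principal when type `θ` plays `a` under `p`: `F_{θ,a} ⬝ (r - p)`. -/
noncomputable def principalUtility (P : PrincipalAgent Θ A O) (θ : Θ) (p : O → ℝ) (a : A) : ℝ :=
  ∑ ω, (P.F θ a ω).toReal * (P.r ω - p ω)

/-- The `δ`-best responses of type `θ` to `p`: the actions whose utility is strictly larger than
the maximum utility minus `δ`. -/
def deltaBestResponses (P : PrincipalAgent Θ A O) (δ : ℝ) (θ : Θ) (p : O → ℝ) : Set A :=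
  {a | ∀ a', P.agentUtility θ p a' - δ < P.agentUtility θ p a}

/-- `resp θ p` is, for every type `θ` and every contract `p` with nonnegative payments, a `δ`-best
response that is worst for the principal. How ties are broken is left free. -/
def IsRobustResponse (P : PrincipalAgent Θ A O) (δ : ℝ) (resp : Θ → (O → ℝ) → A) : Prop :=
  ∀ θ (p : O → ℝ), (∀ ω, 0 ≤ p ω) →
    resp θ p ∈ P.deltaBestResponses δ θ p ∧
      ∀ a ∈ P.deltaBestResponses δ θ p,
        P.principalUtility θ p (resp θ p) ≤ P.principalUtility θ p a

/-- The principal's expected utility for committing to `p`, averaged over the agent's type, when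
the agent responds according to `resp`. -/
noncomputable def expectedUtility (P : PrincipalAgent Θ A O) (resp : Θ → (O → ℝ) → A)
    (p : O → ℝ) : ℝ :=
  ∑ θ, (P.typeLaw θ).toReal * P.principalUtility θ p (resp θ p)

variable (O) in
/-- The hypercube `[0,1]^m` of contracts. -/
def cube : Set (O → ℝ) := {p | ∀ ω, p ω ∈ Set.Icc (0 : ℝ) 1}

/-- The value of an optimal robust contract in the hypercube. -/
noncomputable def cubeOpt (P : PrincipalAgent Θ A O) (resp : Θ → (O → ℝ) → A) : ℝ :=
  sSup (P.expectedUtility resp '' cube O)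

/-! ### The repeated interaction and the regret -/

/-- The principal's realized utility `r_ω - p_ω ∈ [-1,1]` in one round, rescaled affinely
to `[0,1]`. -/
noncomputable def feedback (P : PrincipalAgent Θ A O) (p : O → ℝ) (ω : O) : ℝ :=
  (1 + (P.r ω - p ω)) / 2

/-- Law of what the principal sees in the first `t` rounds (the contracts and the feedback, most
recent round first) when the contract of each round is chosen by the policy `π` from the past.
In each round a type is drawn from `typeLaw`, the agent plays `resp`, and an outcome is drawn from
the distribution of the action played. -/
noncomputable def historyLaw (P : PrincipalAgent Θ A O) (resp : Θ → (O → ℝ) → A)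
    (π : List ((O → ℝ) × ℝ) → (O → ℝ)) : ℕ → PMF (List ((O → ℝ) × ℝ))
  | 0 => PMF.pure []
  | t + 1 => (historyLaw P resp π t).bind fun h =>
      P.typeLaw.bind fun θ =>
        (P.F θ (resp θ (π h))).map fun ω => (π h, P.feedback (π h) ω) :: h

/-- The expectation of `∑_{t ≤ T} ∑_θ λ_θ u(p^t, a^θ(p^t), θ)` over the interaction (the history
law has finite support, so the series is a finite sum). -/
noncomputable def expectedCumulativeUtility (P : PrincipalAgent Θ A O)
    (resp : Θ → (O → ℝ) → A) (π : List ((O → ℝ) × ℝ) → (O → ℝ)) (T : ℕ) : ℝ :=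
  ∑' h, (P.historyLaw resp π T h).toReal * (h.map fun x => P.expectedUtility resp x.1).sum

/-- The cumulative pseudo-regret over `T` rounds against the best robust contract in the cube. -/
noncomputable def regret (P : PrincipalAgent Θ A O) (resp : Θ → (O → ℝ) → A)
    (π : List ((O → ℝ) × ℝ) → (O → ℝ)) (T : ℕ) : ℝ :=
  T * P.cubeOpt resp - P.expectedCumulativeUtility resp π T

end PrincipalAgent

/-! ### UCB1 -/

section UCB

variable {α : Type*}

open Classical in
/-- The feedback received from arm `a` in the history `h`. -/
noncomputable def armRewards (h : List (α × ℝ)) (a : α) : List ℝ :=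
  (h.filter fun x => x.1 = a).map Prod.snd

/-- The UCB1 index of arm `a`: the average feedback `x̄_a` plus `√(2 log n / n_a)`, where `n_a` is
the number of plays of `a` and `n` the total number of plays so far. -/
noncomputable def ucbIndex (h : List (α × ℝ)) (a : α) : ℝ :=
  (armRewards h a).sum / (armRewards h a).length +
    √(2 * Real.log h.length / (armRewards h a).length)

/-- `π` runs UCB1 on the given arms: while some arm has not been played, play such an arm;
afterwards play an arm of maximal index. The initial order and the ties are left free. -/
def IsUCB1 (arms : Set α) (π : List (α × ℝ) → α) : Prop :=
  ∀ h, π h ∈ arms ∧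
    ((∃ a ∈ arms, armRewards h a = []) → armRewards h (π h) = []) ∧
    ((∀ a ∈ arms, armRewards h a ≠ []) → ∀ a ∈ arms, ucbIndex h a ≤ ucbIndex h (π h))

end UCB

/-! ### The algorithm -/

/-- The uniform grid of `[0,1]^m` with step `ε`: every coordinate is in `{0, ε, 2ε, …, 1}`, i.e. is
a multiple of `ε` in `[0,1]` or the right end point `1`. -/
def uniformGrid (O : Type*) (ε : ℝ) : Set (O → ℝ) :=
  {p | ∀ ω, p ω ∈ Set.Icc (0 : ℝ) 1 ∧ ((∃ k : ℕ, p ω = k * ε) ∨ p ω = 1)}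

/-- `π` is the algorithm for horizon `T`: UCB1 with the grid of step `T^{-1/(m+1)}` as arms. -/
def IsGridUCB1 (O : Type*) [Fintype O] (T : ℕ) (π : List ((O → ℝ) × ℝ) → (O → ℝ)) : Prop :=
  IsUCB1 (uniformGrid O ((T : ℝ) ^ (-(1 / ((Fintype.card O : ℝ) + 1))))) π

/-!
The principal's expected utility against a robustly responding agent is upper semicontinuous,
because `δ`-best responses are given by strict inequalities and so persist under small changes of
the contract; on the compact cube it attains its maximum
(`PrincipalAgent.IsRobustResponse.isGreatest_cubeOpt`).

This utility is not continuous, so rounding an optimal contract `p` to the grid may cost a lot. One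
first moves `p` by the fraction `√ε` of the way towards the reward vector, and then rounds down to a
contract `p'`. An action that becomes a `δ`-best response only at `p'` has gained on the agent's
best response to `p`; since the change of the contract is `√ε (r - p)` up to `ε`, that action is,
under `p`, at most `√ε` worse for the principal than the agent's best response. So the grid contains
a contract that is optimal up to `2√ε`
(`PrincipalAgent.IsRobustResponse.exists_mem_uniformGrid`).

The interaction restricted to the grid is a stochastic bandit, for which UCB1 satisfies a regret
bound of order `log T √(K T)` with `K` arms (`Bandit.ucb1_regret_le`). The expectation over the
history is a linear functional defined by recursion on the number of rounds. For each arm and each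
real `l`, the process `exp (l (S - μ N) - l² N / 8)`, with `N` plays, sum of rewards `S` and mean
reward `μ`, is a supermartingale by Hoeffding's lemma; this bounds the probability that a confidence
interval fails for each of the possible values of `N`, without passing to independent copies of the
rewards. When
every arm has been played and no interval fails, the regret of a round is at most a multiple of
`log T / √N`, where `N` counts the plays of the chosen arm. This is paid by the increase of the
potential `∑ √N` over the arms, which also pays for the first play of every arm, and the
potential is at most `√(K T)`.

With `ε = T ^ (-1 / (m + 1))` both errors are of the order `T ^ (1 - 1 / (2 (m + 1)))` up to a
logarithm. The number of arms is at most `(1 / ε + 2) ^ m`, which is comparable with `ε ^ (-m)` only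
if `m ε` is bounded; in the remaining cases the trivial bound `2 T` is already good enough, so the
constant does not depend on `m` (`regret_rate_le`).
-/

/-! ### Expectations under finitely supported laws -/

section PMF

/-- The law of total expectation for finitely supported laws. -/
theorem PMF.tsum_bind_toReal_mul {β γ : Type*} (p : PMF β) (q : β → PMF γ)
    (hp : p.support.Finite) (hq : ∀ x, (q x).support.Finite) (f : γ → ℝ) :
    ∑' y, ((p.bind q) y).toReal * f y =
      ∑' x, (p x).toReal * ∑' y, (q x y).toReal * f y := by
  classical
  have hR : (⋃ x ∈ p.support, (q x).support).Finite := hp.biUnion fun x _ => hq x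
  have hbind : ∀ y, ((p.bind q) y).toReal = ∑ x ∈ hp.toFinset, (p x).toReal * (q x y).toReal := by
    intro y
    rw [PMF.bind_apply, tsum_eq_sum (s := hp.toFinset)]
    · rw [ENNReal.toReal_sum]
      · simp [ENNReal.toReal_mul]
      · exact fun x _ => ENNReal.mul_ne_top (p.apply_ne_top x) ((q x).apply_ne_top y)
    · intro x hx
      have : p x = 0 := by simpa [PMF.mem_support_iff] using hx
      simp [this]
  rw [tsum_eq_sum (s := hR.toFinset), tsum_eq_sum (s := hp.toFinset)]
  · simp_rw [hbind, Finset.sum_mul]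
    rw [Finset.sum_comm]
    refine Finset.sum_congr rfl fun x hx => ?_
    rw [tsum_eq_sum (s := hR.toFinset), Finset.mul_sum]
    · simp [mul_assoc]
    · intro y hy
      have hx' : x ∈ p.support := by simpa using hx
      have : q x y = 0 := by
        by_contra h
        exact hy (by simpa using ⟨x, hx', h⟩)
      simp [this]
  · intro x hx
    have : p x = 0 := by simpa [PMF.mem_support_iff] using hx
    simp [this]
  · intro y hy
    have : (p.bind q) y = 0 := by
      by_contra h
      have h' : y ∈ (p.bind q).support := h
      rw [PMF.mem_support_bind_iff] at h'
      exact hy (by simpa using h')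
    simp [this]

theorem PMF.sum_toReal_eq_one {Ω : Type*} [Fintype Ω] (p : PMF Ω) : ∑ ω, (p ω).toReal = 1 := by
  rw [← ENNReal.toReal_sum fun ω _ => p.apply_ne_top ω, ← tsum_fintype (L := .unconditional Ω),
    p.tsum_coe]
  simp

theorem PMF.sum_toReal_mul_le {Ω : Type*} [Fintype Ω] (p : PMF Ω) {f g : Ω → ℝ}
    (h : ∀ ω, f ω ≤ g ω) : ∑ ω, (p ω).toReal * f ω ≤ ∑ ω, (p ω).toReal * g ω :=
  Finset.sum_le_sum fun ω _ => mul_le_mul_of_nonneg_left (h ω) ENNReal.toReal_nonneg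

theorem PMF.sum_toReal_mul_const {Ω : Type*} [Fintype Ω] (p : PMF Ω) (c : ℝ) :
    ∑ ω, (p ω).toReal * c = c := by
  rw [← Finset.sum_mul, p.sum_toReal_eq_one, one_mul]

/-- Hoeffding's lemma for a random variable with values in `[0,1]` on a finite space. -/
theorem PMF.sum_exp_le {Ω : Type*} [Fintype Ω] (p : PMF Ω) (X : Ω → ℝ)
    (hX : ∀ ω, X ω ∈ Set.Icc (0 : ℝ) 1) (l : ℝ) :
    ∑ ω, (p ω).toReal * Real.exp (l * (X ω - ∑ ω', (p ω').toReal * X ω')) ≤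
      Real.exp (l ^ 2 / 8) := by
  let _ : MeasurableSpace Ω := ⊤
  have hint : ∀ f : Ω → ℝ, ∫ ω, f ω ∂p.toMeasure = ∑ ω, (p ω).toReal * f ω := fun f => by
    simpa using p.integral_eq_sum f
  have h := ProbabilityTheory.hasSubgaussianMGF_of_mem_Icc (μ := p.toMeasure) (X := X)
    (a := 0) (b := 1) (measurable_of_finite X).aemeasurable (.of_forall hX)
  have h1 := h.mgf_le l
  rw [ProbabilityTheory.mgf, hint, hint] at h1
  refine h1.trans (Real.exp_le_exp.2 ?_)
  norm_num
  linarith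

end PMF

/-! ### Expectations over the history of a stochastic bandit -/

namespace Bandit

variable {α Ω : Type*} [Fintype Ω]

/-- The conditional expectation of `f` of the next history given the current one: the arm `π h` is
played, an outcome `ω` is drawn from `q (π h)` and the reward `g (π h) ω` is received. -/
noncomputable def step (q : α → PMF Ω) (g : α → Ω → ℝ) (π : List (α × ℝ) → α) :
    (List (α × ℝ) → ℝ) →ₗ[ℝ] (List (α × ℝ) → ℝ) where
  toFun f h := ∑ ω, (q (π h) ω).toReal * f ((π h, g (π h) ω) :: h)
  map_add' f f' := by
    ext h
    simp [mul_add, Finset.sum_add_distrib]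
  map_smul' c f := by
    ext h
    simp [Finset.mul_sum, mul_left_comm]

/-- The expectation of `f` of the history of the first `t` rounds, as a linear functional of `f`. -/
noncomputable def historyExp (q : α → PMF Ω) (g : α → Ω → ℝ) (π : List (α × ℝ) → α) :
    ℕ → (List (α × ℝ) → ℝ) →ₗ[ℝ] ℝ
  | 0 => LinearMap.proj []
  | t + 1 => (historyExp q g π t).comp (step q g π)

variable (q : α → PMF Ω) (g : α → Ω → ℝ) (π : List (α × ℝ) → α)

theorem step_apply (f : List (α × ℝ) → ℝ) (h : List (α × ℝ)) :
    step q g π f h = ∑ ω, (q (π h) ω).toReal * f ((π h, g (π h) ω) :: h) := rfl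

@[simp] theorem historyExp_zero (f : List (α × ℝ) → ℝ) : historyExp q g π 0 f = f [] := rfl

theorem historyExp_succ (t : ℕ) (f : List (α × ℝ) → ℝ) :
    historyExp q g π (t + 1) f = historyExp q g π t (step q g π f) := rfl

theorem step_const (c : ℝ) : step q g π (fun _ => c) = fun _ => c := by
  ext h
  rw [step_apply, ← Finset.sum_mul, PMF.sum_toReal_eq_one, one_mul]

theorem historyExp_const (t : ℕ) (c : ℝ) : historyExp q g π t (fun _ => c) = c := by
  induction t with
  | zero => rfl
  | succ t ih => rw [historyExp_succ, step_const, ih]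

/-- Inequalities have to be checked only on histories of the right length that use arms which the
policy can play. -/
theorem historyExp_mono {arms : Set α} (hπ : ∀ h, π h ∈ arms) (t : ℕ) {f f' : List (α × ℝ) → ℝ}
    (hf : ∀ h : List (α × ℝ), h.length = t → (∀ x ∈ h, x.1 ∈ arms) → f h ≤ f' h) :
    historyExp q g π t f ≤ historyExp q g π t f' := by
  induction t generalizing f f' with
  | zero => exact hf [] rfl (by simp)
  | succ t ih =>
    refine ih fun h hh ha => Finset.sum_le_sum fun ω _ =>
      mul_le_mul_of_nonneg_left (hf _ (by simp [hh]) ?_) ENNReal.toReal_nonneg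
    intro x hx
    rcases List.mem_cons.1 hx with rfl | hx
    · exact hπ h
    · exact ha x hx

/-! ### Concentration of the empirical means -/

/-- The expected reward of an arm. -/
noncomputable def mean (a : α) : ℝ := ∑ ω, (q a ω).toReal * g a ω

theorem mean_mem {a : α} (hg : ∀ ω, g a ω ∈ Set.Icc (0 : ℝ) 1) :
    mean q g a ∈ Set.Icc (0 : ℝ) 1 := by
  have h0 := PMF.sum_toReal_mul_le (q a) fun ω => (hg ω).1
  have h1 := PMF.sum_toReal_mul_le (q a) fun ω => (hg ω).2
  rw [PMF.sum_toReal_mul_const] at h0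
  exact ⟨h0, by rwa [PMF.sum_toReal_mul_const] at h1⟩

theorem armRewards_cons (h : List (α × ℝ)) (a b : α) (x : ℝ) [Decidable (a = b)] :
    armRewards ((a, x) :: h) b = if a = b then x :: armRewards h b else armRewards h b := by
  classical
  by_cases hab : a = b <;> simp [armRewards, hab]

/-- The number of plays of an arm. -/
noncomputable def plays (h : List (α × ℝ)) (a : α) : ℕ := (armRewards h a).length

/-- The sum of the deviations of the rewards of an arm from their mean. -/
noncomputable def deviation (h : List (α × ℝ)) (a : α) : ℝ :=
  (armRewards h a).sum - mean q g a * plays h a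

/-- The exponential supermartingale of an arm. -/
noncomputable def expWeight (l : ℝ) (a : α) (h : List (α × ℝ)) : ℝ :=
  Real.exp (l * deviation q g h a - l ^ 2 / 8 * plays h a)

theorem step_expWeight_le (l : ℝ) {a : α} (hg : ∀ ω, g a ω ∈ Set.Icc (0 : ℝ) 1)
    (h : List (α × ℝ)) : step q g π (expWeight q g l a) h ≤ expWeight q g l a h := by
  classical
  rw [step_apply]
  by_cases hab : π h = a
  · have key : ∀ ω, expWeight q g l a ((π h, g (π h) ω) :: h) =
        expWeight q g l a h * Real.exp (-(l ^ 2 / 8)) *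
          Real.exp (l * (g a ω - mean q g a)) := fun ω => by
      simp only [expWeight, deviation, plays, armRewards_cons, hab, if_true, ← Real.exp_add,
        List.sum_cons, List.length_cons]
      congr 1
      push_cast
      ring
    simp_rw [key, hab, mul_left_comm _ (expWeight q g l a h * _), ← Finset.mul_sum]
    have h0 : 0 < expWeight q g l a h := Real.exp_pos _
    calc _ ≤ expWeight q g l a h * Real.exp (-(l ^ 2 / 8)) * Real.exp (l ^ 2 / 8) :=
          mul_le_mul_of_nonneg_left ((q a).sum_exp_le (g a) hg l) (by positivity)
      _ = _ := by rw [mul_assoc, ← Real.exp_add, neg_add_cancel, Real.exp_zero, mul_one]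
  · have key : ∀ ω, expWeight q g l a ((π h, g (π h) ω) :: h) = expWeight q g l a h := fun ω => by
      simp only [expWeight, deviation, plays, armRewards_cons, hab, if_false]
    simp_rw [key]
    rw [PMF.sum_toReal_mul_const]

theorem historyExp_expWeight_le_one (l : ℝ) {a : α} (hg : ∀ ω, g a ω ∈ Set.Icc (0 : ℝ) 1)
    (t : ℕ) : historyExp q g π t (expWeight q g l a) ≤ 1 := by
  induction t with
  | zero => simp [expWeight, deviation, plays, armRewards]
  | succ t ih =>
    refine le_trans ?_ ih
    exact historyExp_mono q g π (arms := Set.univ) (fun _ => trivial) t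
      fun h _ _ => step_expWeight_le q g π l hg h

variable (arms : Finset α)

theorem sum_plays_le_length (h : List (α × ℝ)) : ∑ a ∈ arms, plays h a ≤ h.length := by
  classical
  induction h with
  | nil => simp [plays, armRewards]
  | cons x h ih =>
    have : ∀ b, plays (x :: h) b = plays h b + if x.1 = b then 1 else 0 := fun b => by
      obtain ⟨a, y⟩ := x
      by_cases hab : a = b <;> simp [plays, armRewards_cons, hab]
    simp only [this, Finset.sum_add_distrib, Finset.sum_ite_eq, List.length_cons]
    split_ifs <;> omega

theorem card_le_length_of_plays_ne_zero {h : List (α × ℝ)}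
    (hh : ∀ a ∈ arms, armRewards h a ≠ []) : arms.card ≤ h.length := by
  refine le_trans ?_ (sum_plays_le_length arms h)
  rw [Finset.card_eq_sum_ones]
  exact Finset.sum_le_sum fun a ha => List.length_pos_iff.2 (hh a ha)

open Classical in
/-- The indicator of the event that every arm has been played and the average reward of some arm is
outside the confidence interval that its UCB1 index uses. -/
noncomputable def failure (h : List (α × ℝ)) : ℝ :=
  if (∀ a ∈ arms, armRewards h a ≠ []) ∧
    ∃ a ∈ arms, √(2 * plays h a * Real.log h.length) < |deviation q g h a| then 1 else 0

theorem failure_le_sum_expWeight {h : List (α × ℝ)} {n : ℕ} (hn : h.length = n) (hn0 : 0 < n) :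
    failure q g arms h ≤ ∑ a ∈ arms, ∑ s ∈ Finset.Icc 1 n, ((n : ℝ) ^ 4)⁻¹ *
      (expWeight q g (4 * √(2 * Real.log n / s)) a h +
        expWeight q g (-(4 * √(2 * Real.log n / s))) a h) := by
  have hpos : ∀ a s, 0 ≤ ((n : ℝ) ^ 4)⁻¹ *
      (expWeight q g (4 * √(2 * Real.log n / (s : ℕ))) a h +
        expWeight q g (-(4 * √(2 * Real.log n / s))) a h) := fun a s => by
    unfold expWeight; positivity
  unfold failure
  split_ifs with hbad
  swap
  · exact Finset.sum_nonneg fun a _ => Finset.sum_nonneg fun s _ => hpos a s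
  obtain ⟨hall, a, ha, hdev⟩ := hbad
  have hs1 : 0 < plays h a := List.length_pos_iff.2 (hall a ha)
  have hsn : plays h a ≤ n := by
    rw [← hn]
    exact (Finset.single_le_sum (f := plays h) (fun _ _ => Nat.zero_le _) ha).trans
      (sum_plays_le_length arms h)
  refine le_trans ?_ (Finset.single_le_sum (f := fun a => ∑ s ∈ Finset.Icc 1 n, ((n : ℝ) ^ 4)⁻¹ *
      (expWeight q g (4 * √(2 * Real.log n / s)) a h +
        expWeight q g (-(4 * √(2 * Real.log n / s))) a h))
      (fun a _ => Finset.sum_nonneg fun s _ => hpos a s) ha)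
  refine le_trans ?_ (Finset.single_le_sum (f := fun s : ℕ => ((n : ℝ) ^ 4)⁻¹ *
      (expWeight q g (4 * √(2 * Real.log n / s)) a h +
        expWeight q g (-(4 * √(2 * Real.log n / s))) a h))
      (fun s _ => hpos a s) (Finset.mem_Icc.2 ⟨hs1, hsn⟩))
  have hn1 : (1 : ℝ) ≤ n := by exact_mod_cast hn0
  have hlog : 0 ≤ Real.log n := Real.log_nonneg hn1
  rw [hn] at hdev
  set s : ℝ := (plays h a : ℝ) with hs
  have hs0 : 0 < s := Nat.cast_pos.2 hs1
  set l : ℝ := 4 * √(2 * Real.log n / s) with hl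
  set d := deviation q g h a with hd
  -- The choice of `l` optimizes the Chernoff bound for `s` plays.
  have hexp : 4 * Real.log n ≤ l * |d| - l ^ 2 / 8 * s := by
    have e1 : l ^ 2 = 32 * Real.log n / s := by
      rw [hl, mul_pow, Real.sq_sqrt (by positivity)]; ring
    have e2 : l * √(2 * s * Real.log n) = 8 * Real.log n := by
      rw [hl, mul_assoc, ← Real.sqrt_mul (by positivity),
        show 2 * Real.log n / s * (2 * s * Real.log n) = (2 * Real.log n) ^ 2 by field_simp,
        Real.sqrt_sq (by positivity)]
      ring
    have e3 : l ^ 2 / 8 * s = 4 * Real.log n := by rw [e1]; field_simp; ring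
    have e4 := mul_le_mul_of_nonneg_left hdev.le (show 0 ≤ l by positivity)
    linarith
  have hpow : Real.exp (4 * Real.log n) = (n : ℝ) ^ 4 := by
    rw [show 4 * Real.log n = Real.log ((n : ℝ) ^ 4) by simp [Real.log_pow],
      Real.exp_log (by positivity)]
  have hmain : (n : ℝ) ^ 4 ≤ expWeight q g l a h + expWeight q g (-l) a h := by
    rw [← hpow]
    refine (Real.exp_le_exp.2 hexp).trans ?_
    have p1 : 0 < expWeight q g l a h := Real.exp_pos _
    have p2 : 0 < expWeight q g (-l) a h := Real.exp_pos _
    rcases abs_cases d with ⟨h1, _⟩ | ⟨h1, _⟩ <;> rw [h1]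
    · exact le_add_of_nonneg_right p2.le
    · refine le_trans (le_of_eq ?_) (le_add_of_nonneg_left p1.le)
      simp only [expWeight, ← hd, ← hs]
      ring_nf
  rw [inv_mul_eq_div, le_div_iff₀ (by positivity), one_mul]
  exact hmain

/-- Once every arm has been played there are at most as many arms as rounds, so the union bound over
the arms and over the number of plays costs a factor `n ^ 2`. The bound is `0` for `n = 0`, where
no arm has been played. -/
theorem historyExp_failure_le (harms : arms.Nonempty)
    (hg : ∀ a ∈ arms, ∀ ω, g a ω ∈ Set.Icc (0 : ℝ) 1) (n : ℕ) :
    historyExp q g π n (failure q g arms) ≤ 2 * ((n : ℝ) ^ 2)⁻¹ := by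
  rcases lt_or_ge n arms.card with hK | hK
  · calc _ ≤ historyExp q g π n (fun _ => 0) := by
          refine historyExp_mono q g π (arms := Set.univ) (fun _ => trivial) n fun h hh _ => ?_
          unfold failure
          rw [if_neg]
          rintro ⟨hall, -⟩
          have := card_le_length_of_plays_ne_zero arms hall
          omega
      _ = 0 := historyExp_const q g π n 0
      _ ≤ _ := by positivity
  have hn0 : 0 < n := harms.card_pos.trans_le hK
  have hn0' : (0 : ℝ) < n := by exact_mod_cast hn0
  let w : ℕ → α → List (α × ℝ) → ℝ := fun s a =>
    expWeight q g (4 * √(2 * Real.log n / s)) a + expWeight q g (-(4 * √(2 * Real.log n / s))) a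
  calc _ ≤ historyExp q g π n (∑ a ∈ arms, ∑ s ∈ Finset.Icc 1 n, ((n : ℝ) ^ 4)⁻¹ • w s a) := by
        refine historyExp_mono q g π (arms := Set.univ) (fun _ => trivial) n fun h hh _ => ?_
        simpa [w, mul_add] using failure_le_sum_expWeight q g arms hh hn0
    _ = ∑ a ∈ arms, ∑ s ∈ Finset.Icc 1 n, ((n : ℝ) ^ 4)⁻¹ * historyExp q g π n (w s a) := by
        simp [map_sum]
    _ ≤ ∑ a ∈ arms, ∑ s ∈ Finset.Icc 1 n, ((n : ℝ) ^ 4)⁻¹ * 2 := by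
        refine Finset.sum_le_sum fun a ha => Finset.sum_le_sum fun s _ =>
          mul_le_mul_of_nonneg_left ?_ (by positivity)
        have h1 := historyExp_expWeight_le_one q g π (4 * √(2 * Real.log n / s)) (hg a ha) n
        have h2 := historyExp_expWeight_le_one q g π (-(4 * √(2 * Real.log n / s))) (hg a ha) n
        simp only [w, map_add]
        linarith
    _ = arms.card * (n * (((n : ℝ) ^ 4)⁻¹ * 2)) := by simp
    _ ≤ n * (n * (((n : ℝ) ^ 4)⁻¹ * 2)) := by
        refine mul_le_mul_of_nonneg_right (by exact_mod_cast hK) (by positivity)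
    _ = _ := by field_simp

/-! ### The regret of UCB1 -/

/-- The potential that pays for the exploration: the sum of the square roots of the numbers of
plays. -/
noncomputable def potential (h : List (α × ℝ)) : ℝ := ∑ a ∈ arms, √(plays h a)

theorem potential_cons {h : List (α × ℝ)} {a : α} (ha : a ∈ arms) (x : ℝ) :
    potential arms ((a, x) :: h) =
      potential arms h + (√(plays h a + 1) - √(plays h a)) := by
  classical
  unfold potential
  rw [← Finset.add_sum_erase _ _ ha, ← Finset.add_sum_erase _ _ ha]
  have h1 : ∑ b ∈ arms.erase a, √(plays ((a, x) :: h) b : ℝ) =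
      ∑ b ∈ arms.erase a, √(plays h b : ℝ) := Finset.sum_congr rfl fun b hb => by
    simp [plays, armRewards_cons, (Finset.ne_of_mem_erase hb).symm]
  have h2 : (plays ((a, x) :: h) a : ℝ) = plays h a + 1 := by simp [plays, armRewards_cons]
  rw [h1, h2]
  ring

theorem potential_le (h : List (α × ℝ)) : potential arms h ≤ √(arms.card * h.length) := by
  refine Real.le_sqrt_of_sq_le ?_
  refine (sq_sum_le_card_mul_sum_sq (s := arms) (f := fun a => √(plays h a : ℝ))).trans ?_
  simp only [Real.sq_sqrt (Nat.cast_nonneg _)]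
  exact mul_le_mul_of_nonneg_left (by exact_mod_cast sum_plays_le_length arms h) (by positivity)

variable {π arms}

/-- The regret of a round is paid by the increase of the potential, unless a confidence interval
fails. -/
theorem gap_le (hπ : IsUCB1 (arms : Set α) π) (hg : ∀ a ∈ arms, ∀ ω, g a ω ∈ Set.Icc (0 : ℝ) 1)
    {b : α} (hb : b ∈ arms) {T : ℕ} {h : List (α × ℝ)} (hh : h.length ≤ T) :
    mean q g b - mean q g (π h) ≤ 8 * (1 + Real.log T) *
      (√(plays h (π h) + 1) - √(plays h (π h))) + failure q g arms h := by
  obtain ⟨hmem, hinit, hmax⟩ := hπ h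
  have hL : 0 ≤ Real.log T := Real.log_natCast_nonneg T
  have hgap : mean q g b - mean q g (π h) ≤ 1 := by
    have h1 := (mean_mem q g (hg b hb)).2
    have h2 := (mean_mem q g (hg (π h) hmem)).1
    linarith
  have hΦ : √(plays h (π h) : ℝ) ≤ √(plays h (π h) + 1) := Real.sqrt_le_sqrt (by linarith)
  by_cases hall : ∃ a ∈ (arms : Set α), armRewards h a = []
  · -- The first play of an arm raises the potential by `1`, which is at least the gap.
    have h0 : plays h (π h) = 0 := by simp [plays, hinit hall]
    have hf : 0 ≤ failure q g arms h := by unfold failure; positivity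
    rw [h0]
    simp only [Nat.cast_zero, zero_add, Real.sqrt_one, Real.sqrt_zero]
    linarith
  push Not at hall
  by_cases hbad : ∃ a ∈ arms, √(2 * plays h a * Real.log h.length) < |deviation q g h a|
  · have hf : failure q g arms h = 1 := by
      unfold failure
      rw [if_pos ⟨hall, hbad⟩]
    rw [hf]
    have : 0 ≤ 8 * (1 + Real.log T) * (√(plays h (π h) + 1) - √(plays h (π h))) :=
      mul_nonneg (by positivity) (by linarith)
    linarith
  have hf : failure q g arms h = 0 := by
    unfold failure
    rw [if_neg fun hc => hbad hc.2]
  push Not at hbad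
  rw [hf, add_zero]
  have hlogn : 0 ≤ Real.log h.length := Real.log_natCast_nonneg _
  have hidx : ∀ a ∈ arms, |ucbIndex h a - √(2 * Real.log h.length / plays h a) - mean q g a| ≤
      √(2 * Real.log h.length / plays h a) := fun a ha => by
    have hpos : (0 : ℝ) < plays h a := by exact_mod_cast List.length_pos_iff.2 (hall a ha)
    have e1 : ucbIndex h a - √(2 * Real.log h.length / plays h a) - mean q g a =
        deviation q g h a / plays h a := by
      unfold ucbIndex deviation
      rw [show ((armRewards h a).length : ℝ) = plays h a from rfl]
      field_simp
      ring
    rw [e1, abs_div, abs_of_pos hpos, div_le_iff₀ hpos]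
    refine (hbad a ha).trans (le_of_eq ?_)
    nth_rewrite 3 [← Real.sqrt_sq hpos.le]
    rw [← Real.sqrt_mul (by positivity)]
    congr 1
    field_simp
  have h1 := (abs_le.1 (hidx b hb)).1
  have h2 := (abs_le.1 (hidx (π h) hmem)).2
  have h3 := hmax hall b hb
  have hpos : (1 : ℝ) ≤ plays h (π h) := by
    exact_mod_cast List.length_pos_iff.2 (hall _ hmem)
  set N : ℝ := (plays h (π h) : ℝ) with hN
  have hgap' : mean q g b - mean q g (π h) ≤ 2 * √(2 * Real.log h.length / N) := by linarith
  have hn : 0 < h.length := (Finset.card_pos.2 ⟨b, hb⟩).trans_le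
    (card_le_length_of_plays_ne_zero arms hall)
  have hlog : Real.log h.length ≤ Real.log T :=
    Real.log_le_log (by exact_mod_cast hn) (by exact_mod_cast hh)
  refine hgap'.trans ?_
  have hsN : 0 < √N := Real.sqrt_pos.2 (by linarith)
  have e1 : √(2 * Real.log h.length / N) ≤ √2 * (1 + Real.log T) / √N := by
    rw [Real.sqrt_div (by positivity), Real.sqrt_mul (by norm_num)]
    gcongr
    refine Real.sqrt_le_iff.2 ⟨by positivity, ?_⟩
    nlinarith
  -- `√(N + 1) - √N = 1 / (√(N + 1) + √N)`, and `N + 1 ≤ 2 * N`.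
  have e2 : 1 / (2 * √2 * √N) ≤ √(N + 1) - √N := by
    have a1 : √(N + 1) ≤ √2 * √N := by
      rw [← Real.sqrt_mul (by norm_num)]
      exact Real.sqrt_le_sqrt (by linarith)
    have a2 : √N ≤ √2 * √N := le_mul_of_one_le_left hsN.le (Real.one_le_sqrt.2 (by norm_num))
    have a3 : (√(N + 1) - √N) * (√(N + 1) + √N) = 1 := by
      have := Real.sq_sqrt (show 0 ≤ N + 1 by linarith)
      have := Real.sq_sqrt (show 0 ≤ N by linarith)
      nlinarith
    rw [div_le_iff₀ (by positivity)]
    exact a3.symm.le.trans (mul_le_mul_of_nonneg_left (by linarith) (by linarith))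
  calc 2 * √(2 * Real.log h.length / N) ≤ 2 * (√2 * (1 + Real.log T) / √N) := by linarith
    _ = 8 * (1 + Real.log T) * (1 / (2 * √2 * √N)) := by
        have : √2 * √2 = 2 := Real.mul_self_sqrt (by norm_num)
        field_simp
        linarith
    _ ≤ _ := mul_le_mul_of_nonneg_left e2 (by positivity)

/-- The gap-free regret bound for UCB1, against any fixed arm. -/
theorem ucb1_regret_le (hπ : IsUCB1 (arms : Set α) π)
    (hg : ∀ a ∈ arms, ∀ ω, g a ω ∈ Set.Icc (0 : ℝ) 1) {b : α} (hb : b ∈ arms) (T : ℕ) :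
    historyExp q g π T (fun h => (h.map fun x => mean q g b - mean q g x.1).sum) ≤
      8 * (1 + Real.log T) * √(arms.card * T) + 4 := by
  have hL : 0 ≤ Real.log T := Real.log_natCast_nonneg T
  set c := 8 * (1 + Real.log T) with hc
  set R : List (α × ℝ) → ℝ := fun h => (h.map fun x => mean q g b - mean q g x.1).sum with hR
  have hind : ∀ t ≤ T, historyExp q g π t (R - c • potential arms) ≤
      ∑ n ∈ Finset.range t, 2 * ((n : ℝ) ^ 2)⁻¹ := by
    intro t
    induction t with
    | zero => intro _; simp [hR, potential, plays, armRewards]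
    | succ t ih =>
      intro ht
      rw [Finset.sum_range_succ, historyExp_succ]
      calc _ ≤ historyExp q g π t ((R - c • potential arms) + failure q g arms) := by
            refine historyExp_mono q g π (fun h => (hπ h).1) t fun h hh _ => ?_
            have := gap_le q g hπ hg hb (h := h) (T := T) (by omega)
            have key : step q g π (R - c • potential arms) h = R h - c * potential arms h +
                (mean q g b - mean q g (π h) -
                  c * (√(plays h (π h) + 1) - √(plays h (π h)))) := by
              rw [step_apply]
              have : ∀ ω, (R - c • potential arms) ((π h, g (π h) ω) :: h) =
                  R h - c * potential arms h + (mean q g b - mean q g (π h) -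
                  c * (√(plays h (π h) + 1) - √(plays h (π h)))) := fun ω => by
                simp only [Pi.sub_apply, Pi.smul_apply, smul_eq_mul, hR, List.map_cons,
                  List.sum_cons, potential_cons arms (hπ h).1]
                ring
              simp_rw [this]
              rw [PMF.sum_toReal_mul_const]
            rw [key]
            simp only [Pi.add_apply, Pi.sub_apply, Pi.smul_apply, smul_eq_mul]
            linarith
        _ = historyExp q g π t (R - c • potential arms) +
              historyExp q g π t (failure q g arms) := map_add _ _ _
        _ ≤ _ := add_le_add (ih (by omega)) (historyExp_failure_le q g π arms ⟨b, hb⟩ hg t)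
  have hsum : ∑ n ∈ Finset.range T, 2 * ((n : ℝ) ^ 2)⁻¹ ≤ 4 := by
    rw [← Finset.mul_sum]
    have h1 := sum_Ioo_inv_sq_le (α := ℝ) 0 T
    have h2 : ∑ n ∈ Finset.range T, ((n : ℝ) ^ 2)⁻¹ = ∑ n ∈ Finset.Ioo 0 T, ((n : ℝ) ^ 2)⁻¹ := by
      refine (Finset.sum_subset (fun n hn => ?_) fun n hn hn' => ?_).symm
      · simp at hn ⊢; omega
      · have : n = 0 := by simp at hn hn'; omega
        simp [this]
    rw [h2]
    norm_num at h1 ⊢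
    linarith
  have hΦ : historyExp q g π T (potential arms) ≤ √(arms.card * T) := by
    rw [← historyExp_const q g π T √(arms.card * T)]
    refine historyExp_mono q g π (arms := Set.univ) (fun _ => trivial) T fun h hh _ => ?_
    rw [← hh]
    exact potential_le arms h
  have h1 := (hind T le_rfl).trans hsum
  rw [map_sub, map_smul, smul_eq_mul] at h1
  have h2 := mul_le_mul_of_nonneg_left hΦ (show 0 ≤ c by positivity)
  linarith

end Bandit

namespace PrincipalAgent

variable {Θ A O : Type*} (P : PrincipalAgent Θ A O)

/-! ### Existence of an optimal robust contract -/

theorem cube_nonempty : (cube O).Nonempty := ⟨0, fun _ => by simp⟩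

theorem isCompact_cube : IsCompact (cube O) := by
  have : cube O = Set.pi Set.univ fun _ => Set.Icc (0 : ℝ) 1 := by
    ext p
    simp only [cube, Set.mem_ofPred_eq, Set.mem_univ_pi]
  rw [this]
  exact isCompact_univ_pi fun _ => isCompact_Icc

section

variable [Fintype O]

theorem continuous_agentUtility (θ : Θ) (a : A) : Continuous fun p => P.agentUtility θ p a := by
  unfold agentUtility
  fun_prop

theorem continuous_principalUtility (θ : Θ) (a : A) :
    Continuous fun p => P.principalUtility θ p a := by
  unfold principalUtility
  fun_prop

variable {P} {δ : ℝ} {resp : Θ → (O → ℝ) → A}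

/-- The set of `δ`-best responses is defined by strict inequalities, so it can only grow under a
small change of the contract, and the minimum of the principal's utility over it can only jump
down. -/
theorem IsRobustResponse.upperSemicontinuousOn [Fintype Θ] [Finite A]
    (hR : P.IsRobustResponse δ resp) :
    UpperSemicontinuousOn (P.expectedUtility resp) (cube O) := by
  refine upperSemicontinuousOn_sum fun θ _ => ?_
  intro p hp y hy
  have h1 : ∀ᶠ p' in nhdsWithin p (cube O),
      (P.typeLaw θ).toReal * P.principalUtility θ p' (resp θ p) < y :=
    ((continuous_const.mul (P.continuous_principalUtility θ (resp θ p))).continuousAt.eventually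
      (gt_mem_nhds hy)).filter_mono nhdsWithin_le_nhds
  have h2 : ∀ᶠ p' in nhdsWithin p (cube O), resp θ p ∈ P.deltaBestResponses δ θ p' := by
    refine Filter.eventually_all.2 fun a' => ?_
    exact (((P.continuous_agentUtility θ a').sub continuous_const).continuousAt.eventually_lt
      (P.continuous_agentUtility θ (resp θ p)).continuousAt
      ((hR θ p fun ω => (hp ω).1).1 a')).filter_mono nhdsWithin_le_nhds
  filter_upwards [h1, h2, self_mem_nhdsWithin] with p' hp1 hp2 hp3
  exact (mul_le_mul_of_nonneg_left ((hR θ p' fun ω => (hp3 ω).1).2 _ hp2)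
    ENNReal.toReal_nonneg).trans_lt hp1

theorem IsRobustResponse.isGreatest_cubeOpt [Fintype Θ] [Finite A]
    (hR : P.IsRobustResponse δ resp) :
    IsGreatest (P.expectedUtility resp '' cube O) (P.cubeOpt resp) := by
  obtain ⟨p, hp, hmax⟩ := hR.upperSemicontinuousOn.exists_isMaxOn cube_nonempty isCompact_cube
  have h : IsGreatest (P.expectedUtility resp '' cube O) (P.expectedUtility resp p) := by
    refine ⟨⟨p, hp, rfl⟩, ?_⟩
    rintro _ ⟨p', hp', rfl⟩
    exact hmax hp'
  rwa [cubeOpt, h.csSup_eq]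

/-! ### The discretization error -/

/-- If `p'` is `p` moved by `s` in the direction of the reward vector, up to a rounding down of each
payment by at most `s ^ 2`, then every `δ`-best response to `p'` which is not one to `p` is almost
as good for the principal as the agent's best response to `p`: the move favours the actions which
the principal likes. -/
theorem IsRobustResponse.principalUtility_le [Finite A] (hR : P.IsRobustResponse δ resp)
    (hδ : 0 < δ) {p p' : O → ℝ} (hp : ∀ ω, 0 ≤ p ω) (hp' : ∀ ω, 0 ≤ p' ω) {s : ℝ} (hs : 0 < s)
    (hle : ∀ ω, p' ω - p ω ≤ s * (P.r ω - p ω))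
    (hge : ∀ ω, s * (P.r ω - p ω) - s ^ 2 ≤ p' ω - p ω) (θ : Θ) :
    P.principalUtility θ p (resp θ p) - 2 * s ≤ P.principalUtility θ p' (resp θ p') := by
  let D : A → ℝ := fun a => ∑ ω, (P.F θ a ω).toReal * (p' ω - p ω)
  have hDle : ∀ a, D a ≤ s * P.principalUtility θ p a := fun a => by
    refine ((P.F θ a).sum_toReal_mul_le hle).trans_eq ?_
    simp only [principalUtility, Finset.mul_sum, mul_left_comm]
  have hDge : ∀ a, s * P.principalUtility θ p a - s ^ 2 ≤ D a := fun a => by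
    refine le_trans (le_of_eq ?_) ((P.F θ a).sum_toReal_mul_le hge)
    simp only [mul_sub _ _ (s ^ 2), Finset.sum_sub_distrib, PMF.sum_toReal_mul_const]
    simp only [principalUtility, Finset.mul_sum, mul_left_comm]
  have hA : ∀ a, P.agentUtility θ p' a = P.agentUtility θ p a + D a := fun a => by
    simp only [agentUtility, D, mul_sub, Finset.sum_sub_distrib]
    ring
  have hU : ∀ a, P.principalUtility θ p' a = P.principalUtility θ p a - D a := fun a => by
    simp only [principalUtility, D, mul_sub, Finset.sum_sub_distrib]
    ring
  obtain ⟨hmem', -⟩ := hR θ p' hp'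
  obtain ⟨-, hmin⟩ := hR θ p hp
  set a := resp θ p' with ha
  have hle1 : P.principalUtility θ p a ≤ 1 := by
    have := (P.F θ a).sum_toReal_mul_le (f := fun ω => P.r ω - p ω) (g := fun _ => 1)
      fun ω => by linarith [(P.r_mem ω).2, hp ω]
    rwa [PMF.sum_toReal_mul_const] at this
  have key : P.principalUtility θ p (resp θ p) ≤ P.principalUtility θ p a + s := by
    by_cases hmem : a ∈ P.deltaBestResponses δ θ p
    · linarith [hmin a hmem]
    · have : Nonempty A := ⟨a⟩
      obtain ⟨b, hb⟩ := Finite.exists_max fun b => P.agentUtility θ p b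
      have hbmem : b ∈ P.deltaBestResponses δ θ p := fun a' => by linarith [hb a']
      simp only [deltaBestResponses, Set.mem_ofPred_eq, not_forall, not_lt] at hmem
      obtain ⟨b', hb'⟩ := hmem
      have h1 := hmem' b
      rw [hA, hA] at h1
      have h2 : s * P.principalUtility θ p b ≤ s * (P.principalUtility θ p a + s) := by
        linarith [hb b', hDle a, hDge b, sq s]
      linarith [le_of_mul_le_mul_left h2 hs, hmin b hbmem]
  have h3 : s * P.principalUtility θ p a ≤ s := mul_le_of_le_one_right hs.le hle1
  rw [hU]
  linarith [hDle a]

/-- Some contract of the grid is optimal up to `2√ε`. -/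
theorem IsRobustResponse.exists_mem_uniformGrid [Fintype Θ] [Finite A]
    (hR : P.IsRobustResponse δ resp) (hδ : 0 < δ) {ε : ℝ} (hε : 0 < ε) (hε1 : ε ≤ 1)
    {p : O → ℝ} (hp : p ∈ cube O) :
    ∃ p' ∈ uniformGrid O ε, P.expectedUtility resp p - 2 * √ε ≤ P.expectedUtility resp p' := by
  have hs : 0 < √ε := Real.sqrt_pos.2 hε
  have hs1 : √ε ≤ 1 := Real.sqrt_le_one.2 hε1
  have hsq : √ε ^ 2 = ε := Real.sq_sqrt hε.le
  set x : O → ℝ := fun ω => p ω + √ε * (P.r ω - p ω) with hx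
  have hx0 : ∀ ω, 0 ≤ x ω := fun ω => by
    nlinarith [(hp ω).1, (P.r_mem ω).1, mul_nonneg hs.le (P.r_mem ω).1,
      mul_nonneg (sub_nonneg.2 hs1) (hp ω).1]
  have hx1 : ∀ ω, x ω ≤ 1 := fun ω => by
    nlinarith [(hp ω).2, (P.r_mem ω).2, mul_nonneg hs.le (sub_nonneg.2 (P.r_mem ω).2),
      mul_nonneg (sub_nonneg.2 hs1) (sub_nonneg.2 (hp ω).2)]
  have hfl : ∀ ω, (⌊x ω / ε⌋₊ : ℝ) * ε ≤ x ω := fun ω =>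
    (le_div_iff₀ hε).1 (Nat.floor_le (div_nonneg (hx0 ω) hε.le))
  have hfl' : ∀ ω, x ω < (⌊x ω / ε⌋₊ : ℝ) * ε + ε := fun ω => by
    have := (div_lt_iff₀ hε).1 (Nat.lt_floor_add_one (x ω / ε))
    linarith
  have hp0 : ∀ ω, 0 ≤ (⌊x ω / ε⌋₊ : ℝ) * ε := fun ω => by positivity
  refine ⟨fun ω => ⌊x ω / ε⌋₊ * ε,
    fun ω => ⟨⟨hp0 ω, (hfl ω).trans (hx1 ω)⟩, Or.inl ⟨_, rfl⟩⟩, ?_⟩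
  rw [← P.typeLaw.sum_toReal_mul_const (2 * √ε)]
  unfold expectedUtility
  rw [← Finset.sum_sub_distrib]
  simp only [← mul_sub]
  refine P.typeLaw.sum_toReal_mul_le fun θ => ?_
  refine hR.principalUtility_le hδ (fun ω => (hp ω).1) hp0 hs (fun ω => ?_) (fun ω => ?_) θ
  · linarith [hfl ω]
  · rw [hsq]
    linarith [hfl' ω]

theorem exists_finset_coe_eq_uniformGrid {ε : ℝ} (hε : 0 < ε) :
    ∃ arms : Finset (O → ℝ), (arms : Set (O → ℝ)) = uniformGrid O ε ∧
      (arms.card : ℝ) ≤ (1 / ε + 2) ^ Fintype.card O := by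
  classical
  let V : Finset ℝ := ((Finset.range (⌊1 / ε⌋₊ + 1)).image (fun k : ℕ => (k : ℝ) * ε) ∪ {1}).filter
    fun x => x ∈ Set.Icc (0 : ℝ) 1
  refine ⟨Fintype.piFinset fun _ => V, ?_, ?_⟩
  · ext p
    simp only [Finset.mem_coe, Fintype.mem_piFinset, uniformGrid, Set.mem_ofPred_eq]
    refine forall_congr' fun ω => ?_
    simp only [V, Finset.mem_filter, Finset.mem_union, Finset.mem_image, Finset.mem_range,
      Finset.mem_singleton, and_comm (b := p ω ∈ Set.Icc (0 : ℝ) 1)]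
    refine and_congr_right fun hω => or_congr_left ⟨?_, ?_⟩
    · rintro ⟨k, -, hk⟩
      exact ⟨k, hk.symm⟩
    · rintro ⟨k, hk⟩
      refine ⟨k, Nat.lt_succ_of_le (Nat.le_floor ?_), hk.symm⟩
      rw [le_div_iff₀ hε, ← hk]
      exact hω.2
  · have hV : (V.card : ℝ) ≤ 1 / ε + 2 := by
      have h1 : V.card ≤ ⌊1 / ε⌋₊ + 1 + 1 :=
        (Finset.card_filter_le _ _).trans <| (Finset.card_union_le _ _).trans <|
          add_le_add (Finset.card_image_le.trans_eq (Finset.card_range _)) (by simp)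
      have h2 : (V.card : ℝ) ≤ ⌊1 / ε⌋₊ + 1 + 1 := by exact_mod_cast h1
      linarith [Nat.floor_le (show 0 ≤ 1 / ε by positivity)]
    rw [Fintype.card_piFinset, Finset.prod_const, Finset.card_univ, Nat.cast_pow]
    gcongr

end

/-! ### The repeated interaction as a stochastic bandit -/

variable (resp : Θ → (O → ℝ) → A)

/-- The law of the outcome of a round in which the contract `p` is posted. -/
noncomputable def outcomeLaw (p : O → ℝ) : PMF O :=
  P.typeLaw.bind fun θ => P.F θ (resp θ p)

theorem feedback_mem {p : O → ℝ} (hp : p ∈ cube O) (ω : O) :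
    P.feedback p ω ∈ Set.Icc (0 : ℝ) 1 := by
  have h1 := hp ω
  have h2 := P.r_mem ω
  simp only [Set.mem_Icc] at h1 h2
  constructor <;> unfold feedback <;> linarith

variable (π : List ((O → ℝ) × ℝ) → (O → ℝ))

theorem historyLaw_succ (t : ℕ) :
    P.historyLaw resp π (t + 1) = (P.historyLaw resp π t).bind fun h =>
      (P.outcomeLaw resp (π h)).bind fun ω => PMF.pure ((π h, P.feedback (π h) ω) :: h) := by
  simp only [outcomeLaw, PMF.bind_bind]
  rfl

theorem finite_support_historyLaw [Finite O] (t : ℕ) : (P.historyLaw resp π t).support.Finite := by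
  induction t with
  | zero => simp [historyLaw]
  | succ t ih =>
    rw [historyLaw_succ, PMF.support_bind]
    refine ih.biUnion fun h _ => ?_
    rw [PMF.support_bind]
    exact (Set.toFinite _).biUnion fun ω _ => by simp

variable [Fintype O]

theorem tsum_historyLaw (t : ℕ) (f : List ((O → ℝ) × ℝ) → ℝ) :
    ∑' h, (P.historyLaw resp π t h).toReal * f h =
      Bandit.historyExp (P.outcomeLaw resp) P.feedback π t f := by
  have hpure : ∀ (h : List ((O → ℝ) × ℝ)) (f : List ((O → ℝ) × ℝ) → ℝ),
      ∑' h', (PMF.pure h h').toReal * f h' = f h := fun h f => by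
    rw [tsum_eq_single h]
    · simp
    · intro h' hh
      simp [PMF.pure_apply, hh]
  induction t generalizing f with
  | zero => exact hpure [] f
  | succ t ih =>
    rw [historyLaw_succ, PMF.tsum_bind_toReal_mul _ _ (P.finite_support_historyLaw resp π t),
      ih, Bandit.historyExp_succ]
    · congr 1
      ext h
      rw [PMF.tsum_bind_toReal_mul _ _ (Set.toFinite _) (fun ω => by simp), tsum_fintype]
      simp only [hpure]
      rfl
    · intro h
      rw [PMF.support_bind]
      exact (Set.toFinite _).biUnion fun ω _ => by simp

variable [Fintype Θ]

theorem mean_outcomeLaw (p : O → ℝ) :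
    Bandit.mean (P.outcomeLaw resp) P.feedback p = (1 + P.expectedUtility resp p) / 2 := by
  have h := P.typeLaw.tsum_bind_toReal_mul (fun θ => P.F θ (resp θ p)) (Set.toFinite _)
    (fun θ => Set.toFinite _) (P.feedback p)
  simp only [tsum_fintype] at h
  have hθ : ∀ θ, ∑ ω, (P.F θ (resp θ p) ω).toReal * P.feedback p ω =
      1 / 2 + P.principalUtility θ p (resp θ p) * (1 / 2) := fun θ => by
    conv_rhs => enter [1]; rw [← (P.F θ (resp θ p)).sum_toReal_mul_const (1 / 2)]
    rw [principalUtility, Finset.sum_mul, ← Finset.sum_add_distrib]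
    refine Finset.sum_congr rfl fun ω _ => ?_
    rw [feedback]
    ring
  rw [Bandit.mean, outcomeLaw, h]
  simp only [hθ, mul_add, Finset.sum_add_distrib, PMF.sum_toReal_mul_const, expectedUtility]
  simp only [← mul_assoc, ← Finset.sum_mul]
  ring

variable {P resp π}

/-- The regret of UCB1 over any finite set of contracts in the cube, against the optimum over the
cube. -/
theorem regret_le_of_isUCB1 {arms : Finset (O → ℝ)} (hπ : IsUCB1 (arms : Set (O → ℝ)) π)
    (harms : ∀ p ∈ arms, p ∈ cube O) {b : O → ℝ} (hb : b ∈ arms) {e : ℝ}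
    (hbe : P.cubeOpt resp - e ≤ P.expectedUtility resp b) (T : ℕ) :
    P.regret resp π T ≤ T * e + 2 * (8 * (1 + Real.log T) * √(arms.card * T) + 4) := by
  have h := Bandit.ucb1_regret_le (P.outcomeLaw resp) P.feedback hπ
    (fun p hp => P.feedback_mem (harms p hp)) hb T
  rw [regret, expectedCumulativeUtility, tsum_historyLaw]
  set E := Bandit.historyExp (P.outcomeLaw resp) P.feedback π T with hE
  set U : List ((O → ℝ) × ℝ) → ℝ := fun h => (h.map fun x => P.expectedUtility resp x.1).sum with hU
  set M : List ((O → ℝ) × ℝ) → ℝ := fun h => (h.map fun x =>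
    Bandit.mean (P.outcomeLaw resp) P.feedback b -
      Bandit.mean (P.outcomeLaw resp) P.feedback x.1).sum with hM
  have hsum : ∀ h, 2 * M h + U h = h.length * P.expectedUtility resp b := fun h => by
    induction h with
    | nil => simp [hM, hU]
    | cons x h ih =>
      simp only [hM, hU, List.map_cons, List.sum_cons, List.length_cons, mean_outcomeLaw] at ih ⊢
      push_cast
      linarith
  have h1 : (T : ℝ) * (P.cubeOpt resp - e) ≤ E ((2 : ℝ) • M + U) := by
    rw [← Bandit.historyExp_const (P.outcomeLaw resp) P.feedback π T
      (T * (P.cubeOpt resp - e))]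
    refine Bandit.historyExp_mono _ _ _ (arms := Set.univ) (fun _ => trivial) T fun h hh _ => ?_
    simp only [Pi.add_apply, Pi.smul_apply, smul_eq_mul, hsum, hh]
    gcongr
  rw [map_add, map_smul, smul_eq_mul] at h1
  linarith

theorem expectedUtility_mem {p : O → ℝ} (hp : p ∈ cube O) :
    P.expectedUtility resp p ∈ Set.Icc (-1 : ℝ) 1 := by
  have h := Bandit.mean_mem (P.outcomeLaw resp) P.feedback (P.feedback_mem hp)
  rw [mean_outcomeLaw, Set.mem_Icc] at h
  constructor <;> linarith

theorem regret_le_two_mul {arms : Set (O → ℝ)} (hπ : ∀ h, π h ∈ arms)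
    (harms : ∀ p ∈ arms, p ∈ cube O) (hopt : P.cubeOpt resp ≤ 1) (T : ℕ) :
    P.regret resp π T ≤ 2 * T := by
  rw [regret, expectedCumulativeUtility, tsum_historyLaw]
  have h1 : -(T : ℝ) ≤ Bandit.historyExp (P.outcomeLaw resp) P.feedback π T
      fun h => (h.map fun x => P.expectedUtility resp x.1).sum := by
    rw [← Bandit.historyExp_const (P.outcomeLaw resp) P.feedback π T (-(T : ℝ))]
    refine Bandit.historyExp_mono _ _ _ hπ T fun h hh ha => ?_
    have := List.card_nsmul_le_sum (h.map fun x => P.expectedUtility resp x.1) (-1) (by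
      simp only [List.mem_map]
      rintro _ ⟨x, hx, rfl⟩
      exact (expectedUtility_mem (harms _ (ha x hx))).1)
    simpa [hh] using this
  have h2 : (T : ℝ) * P.cubeOpt resp ≤ T := mul_le_of_le_one_right (Nat.cast_nonneg T) hopt
  linarith

end PrincipalAgent

/-! ### The choice of the step of the grid -/

/-- If `y = T ^ (1 / (2 * (m + 1)))` is not much larger than `1 + log T`, then the bound is larger
than the trivial one. Otherwise `m` is small compared with `y ^ 2`, so the number of arms is at most
`3 * y ^ (2 * m)`, and no constant depending on `m` appears. -/
theorem regret_rate_le (m T : ℕ) (hT : 1 ≤ T) {R K : ℝ} (hR : R ≤ 2 * T)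
    (hK : K ≤ (1 / (T : ℝ) ^ (-(1 / ((m : ℝ) + 1))) + 2) ^ m)
    (hRK : R ≤ T * (2 * √((T : ℝ) ^ (-(1 / ((m : ℝ) + 1))))) +
      2 * (8 * (1 + Real.log T) * √(K * T) + 4)) :
    R ≤ 60 * (1 + Real.log T) * (T : ℝ) ^ (1 - 1 / (2 * ((m : ℝ) + 1))) := by
  have hT1 : (1 : ℝ) ≤ T := by exact_mod_cast hT
  have hT0 : (0 : ℝ) < T := by linarith
  have hlog : 0 ≤ Real.log T := Real.log_nonneg hT1
  set L := 1 + Real.log T with hL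
  have hL1 : 1 ≤ L := by linarith
  set y : ℝ := (T : ℝ) ^ (1 / (2 * ((m : ℝ) + 1))) with hy
  have hy0 : 0 < y := by positivity
  have hTy : (T : ℝ) = y ^ (2 * m + 2) := by
    rw [hy, ← Real.rpow_natCast, ← Real.rpow_mul hT0.le]
    push_cast
    rw [show 1 / (2 * ((m : ℝ) + 1)) * (2 * m + 2) = 1 by field_simp, Real.rpow_one]
  have hε : (T : ℝ) ^ (-(1 / ((m : ℝ) + 1))) = (y ^ 2)⁻¹ := by
    rw [hy, ← Real.rpow_natCast, ← Real.rpow_mul hT0.le, ← Real.rpow_neg hT0.le]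
    congr 1
    push_cast
    field_simp
  have hrate : (T : ℝ) ^ (1 - 1 / (2 * ((m : ℝ) + 1))) = y ^ (2 * m + 1) := by
    rw [Real.rpow_sub hT0, Real.rpow_one, ← hy, hTy, pow_succ, mul_div_assoc, div_self hy0.ne',
      mul_one]
  rw [hrate]
  rcases le_or_gt y (30 * L) with hyL | hyL
  · refine hR.trans ?_
    rw [hTy, pow_succ]
    nlinarith [mul_le_mul_of_nonneg_left hyL (show 0 ≤ y ^ (2 * m + 1) by positivity)]
  have hmy : (m : ℝ) ≤ y := by
    have h1 : Real.log T = (2 * m + 2) * Real.log y := by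
      conv_lhs => rw [hTy, Real.log_pow]
      push_cast
      ring
    have h2 : 1 ≤ Real.log y := by
      rw [Real.le_log_iff_exp_le hy0]
      linarith [Real.exp_one_lt_d9]
    nlinarith [(Nat.cast_nonneg m : (0 : ℝ) ≤ m)]
  have hK' : K ≤ 3 * y ^ (2 * m) := by
    refine hK.trans ?_
    rw [hε, one_div, inv_inv, show y ^ 2 + 2 = (2 / y ^ 2 + 1) * y ^ 2 by field_simp; ring, mul_pow,
      ← pow_mul]
    refine mul_le_mul_of_nonneg_right ?_ (by positivity)
    calc (2 / y ^ 2 + 1) ^ m ≤ Real.exp (2 / y ^ 2) ^ m :=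
          pow_le_pow_left₀ (by positivity) (Real.add_one_le_exp _) m
      _ = Real.exp (m * (2 / y ^ 2)) := (Real.exp_nat_mul _ m).symm
      _ ≤ Real.exp 1 := by
          refine Real.exp_le_exp.2 ?_
          rw [mul_div_assoc', div_le_one (by positivity)]
          nlinarith
      _ ≤ 3 := by linarith [Real.exp_one_lt_d9]
  have hsqrt : √(K * T) ≤ 2 * y ^ (2 * m + 1) := by
    refine Real.sqrt_le_iff.2 ⟨by positivity, ?_⟩
    calc K * T ≤ 3 * y ^ (2 * m) * T := mul_le_mul_of_nonneg_right hK' hT0.le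
      _ = 3 * (y ^ (2 * m + 1)) ^ 2 := by
          rw [hTy]
          ring
      _ ≤ _ := by nlinarith [sq_nonneg (y ^ (2 * m + 1))]
  have hε' : (T : ℝ) * (2 * √((T : ℝ) ^ (-(1 / ((m : ℝ) + 1))))) = 2 * y ^ (2 * m + 1) := by
    rw [hε, Real.sqrt_inv, Real.sqrt_sq hy0.le, hTy, pow_succ]
    field_simp
  have h1 : 1 ≤ y ^ (2 * m + 1) := one_le_pow₀ (by linarith)
  rw [hε'] at hRK
  nlinarith [mul_le_mul_of_nonneg_left hsqrt (show 0 ≤ L by linarith),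
    mul_le_mul_of_nonneg_left h1 (show 0 ≤ L by linarith),
    mul_le_mul_of_nonneg_right hL1 (show 0 ≤ y ^ (2 * m + 1) by linarith)]

theorem mainTheorem2 :
    ∃ (C : ℝ) (k : ℕ), 0 < C ∧
      ∀ (Θ A O : Type*) [Fintype Θ] [Fintype A] [Fintype O]
        (P : PrincipalAgent Θ A O) (δ : ℝ), 0 < δ → δ < 1 →
      ∀ (resp : Θ → (O → ℝ) → A), P.IsRobustResponse δ resp →
        IsGreatest (P.expectedUtility resp '' PrincipalAgent.cube O) (P.cubeOpt resp) ∧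
        ∀ (T : ℕ), 1 ≤ T →
        ∀ (π : List ((O → ℝ) × ℝ) → (O → ℝ)), IsGridUCB1 O T π →
          P.regret resp π T ≤
            C * (1 + Real.log T) ^ k *
              (T : ℝ) ^ (1 - 1 / (2 * ((Fintype.card O : ℝ) + 1))) := by
  refine ⟨60, 1, by norm_num, ?_⟩
  intro Θ A O _ _ _ P δ hδ _ resp hR
  refine ⟨hR.isGreatest_cubeOpt, fun T hT π hπ => ?_⟩
  have hT1 : (1 : ℝ) ≤ T := by exact_mod_cast hT
  have hT0 : (0 : ℝ) < T := by linarith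
  set ε : ℝ := (T : ℝ) ^ (-(1 / ((Fintype.card O : ℝ) + 1))) with hε
  have hε0 : 0 < ε := Real.rpow_pos_of_pos hT0 _
  have hε1 : ε ≤ 1 := Real.rpow_le_one_of_one_le_of_nonpos hT1 (by simp; positivity)
  obtain ⟨p, hp, hpopt⟩ := hR.isGreatest_cubeOpt.1
  obtain ⟨b, hb, hbe⟩ := hR.exists_mem_uniformGrid hδ hε0 hε1 hp
  obtain ⟨arms, harms, hcard⟩ := PrincipalAgent.exists_finset_coe_eq_uniformGrid (O := O) hε0
  have hcube : ∀ p ∈ uniformGrid O ε, p ∈ PrincipalAgent.cube O := fun p hp ω => (hp ω).1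
  have hopt : P.cubeOpt resp ≤ 1 := hpopt ▸ (PrincipalAgent.expectedUtility_mem hp).2
  rw [pow_one]
  refine regret_rate_le (Fintype.card O) T hT
    (PrincipalAgent.regret_le_two_mul (fun h => (hπ h).1) hcube hopt T) hcard ?_
  refine PrincipalAgent.regret_le_of_isUCB1 (arms := arms) (b := b) (by rwa [harms])
    (fun p hp => hcube p (by rwa [← harms])) (by rwa [← Finset.mem_coe, harms]) ?_ T
  rw [← hpopt]
  exact hbe
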